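/- Let $E$ be a finite set. A family $\Phi\subseteq 2^E$ is an interval if $F\subseteq G\subseteq H$ and $F,H\in\Phi$ imply $G\in\Phi$; its vertices are the elements of $E$, and $\Phi_i$ is the set of members of $\Phi$ with $i+1$ elements. Let $C_i(\Phi;\mathbb R)$ be the real vector space with basis $\Phi_i$, let $\partial_i\colon C_i(\Phi;\mathbb R)\to C_{i-1}(\Phi;\mathbb R)$ be the usual signed simplicial boundary map with respect to a linear order of the vertices (terms $F-v\notin\Phi$ being dropped), let $\partial_i^*$ be its transpose, and let $L_i(\Phi)=\partial_{i+1}\partial_{i+1}^*+\partial_i^*\partial_i$, with multiset of (non-negative real) eigenvalues $\mathbf s_i(\Phi)$. Put $$S_\Phi(t,q)=\sum_{i\ge 0}t^i\sum_{\lambda\in\mathbf s_{i-1}(\Phi)}q^\lambda ,$$ a polynomial in $t$ whose coefficients are formal integer combinations of real powers of $q$. For $v\in E$ put $\Phi-v=\{F\in\Phi: v\notin F\}$, $\Phi/v=\{F-v: v\in F\in\Phi\}$, and let $\Phi\,||\,v$ be $\Phi$ with all pairs $\{F,F\cup v\}$ removed for which $v\notin F$ and both $F$ and $F\cup v$ belong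 to $\Phi$. The interval $\Phi$ satisfies the spectral recursion if, for every vertex $v\in E$, $$S_\Phi(t,q)=q\,S_{\Phi-v}(t,q)+qt\,S_{\Phi/v}(t,q)+(1-q)\,S_{\Phi||v}(t,q).$$ **Theorem.** Let $M$ be a matroid on a finite ground set $E$, let $e\in E$, and let $IN(\cdot)$ denote the complex of independent sets. Then the matroid pair $(IN(M-e),IN(M/e))=IN(M-e)\setminus IN(M/e)$ is an interval on $E$ and satisfies the spectral recursion. If $e$ is a loop of $M$, this holds under both conventions for $IN(M/e)$: when it is read as $IN(M)/e=\{F-e: e\in F\in IN(M)\}=\emptyset$ (so that the pair is $IN(M)$), and when $M/e$ is read as the matroid contraction, equal to $M-e$ (so that the pair is empty). -/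

import Mathlib

open scoped Matrix

namespace SpectralRecursion

/-- `Φ` is an interval of the Boolean algebra of subsets of the finite ground set `E`. -/
def IsInterval {α : Type*} (E : Finset α) (Φ : Finset (Finset α)) : Prop :=
  (∀ F ∈ Φ, F ⊆ E) ∧ ∀ F ∈ Φ, ∀ H ∈ Φ, ∀ G : Finset α, F ⊆ G → G ⊆ H → G ∈ Φ

section Operations

variable {α : Type*} [DecidableEq α]

/-- The relative pair `(Δ, Δ')`, i.e. the set difference `Δ - Δ'`. -/
def relPair (Δ Δ' : Finset (Finset α)) : Finset (Finset α) := Δ \ Δ'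

/-- The deletion `Φ - e = {F ∈ Φ : e ∉ F}`. -/
def deletion (Φ : Finset (Finset α)) (e : α) : Finset (Finset α) :=
  Φ.filter fun F => e ∉ F

/-- The contraction `Φ / e = {F - e : F ∈ Φ, e ∈ F}`. -/
def contraction (Φ : Finset (Finset α)) (e : α) : Finset (Finset α) :=
  (Φ.filter fun F => e ∈ F).image fun F => F.erase e

/-- The star of `e` in `Φ`: the union of all pairs `{F, F ∪ e}` with `e ∉ F` both of whose
members lie in `Φ`. For a face `F` of `Φ` the pair containing it is `{F - e, F ∪ e}`. -/
def star (Φ : Finset (Finset α)) (e : α) : Finset (Finset α) :=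
  Φ.filter fun F => F.erase e ∈ Φ ∧ insert e F ∈ Φ

/-- The reduction `Φ || e`. -/
def reduction (Φ : Finset (Finset α)) (e : α) : Finset (Finset α) :=
  Φ \ star Φ e

end Operations

/-- The faces of dimension `i`; a face with `k` elements has dimension `k - 1`,
so the empty face has dimension `-1`. -/
def faces {α : Type*} (Φ : Finset (Finset α)) (i : ℤ) : Finset (Finset α) :=
  Φ.filter fun F => (F.card : ℤ) - 1 = i

section Laplacian

variable {α : Type*} [LinearOrder α]

/-- The coefficient of `[F]` in the boundary of `[G]`, all faces being oriented by the order of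
the vertices: `(-1) ^ j` if `F = G - v` where `v ∈ G` has exactly `j` predecessors in `G`,
and `0` if `F` is not of the form `G - v` with `v ∈ G`. (At most one `v` contributes.) -/
def incidence (F G : Finset α) : ℝ :=
  ∑ v ∈ G, if F = G.erase v then (-1) ^ (G.filter fun w => w < v).card else 0

/-- The matrix, in the bases of faces, of the boundary operator `∂_i : C_i(Φ; ℝ) → C_{i-1}(Φ; ℝ)`.
Here `j` is the target dimension, to be taken equal to `i - 1`. -/
def boundary (Φ : Finset (Finset α)) (j i : ℤ) : Matrix (faces Φ j) (faces Φ i) ℝ :=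
  Matrix.of fun F G => incidence F.1 G.1

/-- The Laplacian `L_i(Φ) = ∂_{i+1} ∂_{i+1}^* + ∂_i^* ∂_i`. -/
def laplacian (Φ : Finset (Finset α)) (i : ℤ) : Matrix (faces Φ i) (faces Φ i) ℝ :=
  boundary Φ i (i + 1) * (boundary Φ i (i + 1))ᵀ
    + (boundary Φ (i - 1) i)ᵀ * boundary Φ (i - 1) i

/-- The multiset of eigenvalues of the (real symmetric) matrix `L_i(Φ)`. -/
noncomputable def eigenvalues (Φ : Finset (Finset α)) (i : ℤ) : Multiset ℝ :=
  (laplacian Φ i).charpoly.roots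

/-- The formal power `q ^ l` for a real exponent `l`: Laplacian eigenvalues need not be integers,
so spectrum polynomials live in `ℤ[q ^ l : l ∈ ℝ][t]`. -/
noncomputable def qPow (l : ℝ) : AddMonoidAlgebra ℤ ℝ := AddMonoidAlgebra.single l 1

/-- The spectrum polynomial `S_Φ(t, q) = ∑_{i ≥ 0} t ^ i ∑_{l ∈ s_{i-1}(Φ)} q ^ l`.
The sum is restricted to the `i` for which `Φ` has a face with `i` elements;
the other terms vanish. -/
noncomputable def spectrumPolynomial (Φ : Finset (Finset α)) :
    Polynomial (AddMonoidAlgebra ℤ ℝ) :=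
  ∑ i ∈ Φ.image Finset.card,
    Polynomial.monomial i ((eigenvalues Φ ((i : ℤ) - 1)).map qPow).sum

/-- The equation of the spectral recursion of `Φ` at `e`:
`S_Φ = q S_{Φ - e} + q t S_{Φ / e} + (1 - q) S_{Φ || e}`. -/
def RecursionAt (Φ : Finset (Finset α)) (e : α) : Prop :=
  spectrumPolynomial Φ =
    Polynomial.C (qPow 1) * spectrumPolynomial (deletion Φ e)
      + Polynomial.C (qPow 1) * Polynomial.X * spectrumPolynomial (contraction Φ e)
      + (1 - Polynomial.C (qPow 1)) * spectrumPolynomial (reduction Φ e)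

/-- `Φ` is an interval on the vertex set `E` that satisfies the spectral recursion,
i.e. satisfies it with respect to every vertex in `E`. -/
def SatisfiesSpectralRecursion (E : Finset α) (Φ : Finset (Finset α)) : Prop :=
  IsInterval E Φ ∧ ∀ v ∈ E, RecursionAt Φ v

end Laplacian

/-- The ground set of a finite matroid, as a `Finset`. -/
noncomputable def groundFinset {α : Type*} (M : Matroid α) [M.Finite] : Finset α :=
  M.ground_finite.toFinset

open Classical in
/-- The independence complex `IN(M)` of a finite matroid. -/
noncomputable def indepComplex {α : Type*} (M : Matroid α) [M.Finite] : Finset (Finset α) :=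
  (groundFinset M).powerset.filter fun F => M.Indep (F : Set α)

end SpectralRecursion

/-! The matroid pair is the family `spanFamily M e` of independent sets that avoid `e` and span it.
Exchange makes its Laplacians block diagonal with respect to closure: if two faces with different
closures differ by one exchange, their common facet and cofacet both lie in the family and
contribute with opposite signs (`IsStratified.sum_cofacet_add_sum_facet`). On the block of a flat
`W` the up-Laplacian is the scalar `|G \ W|`, with `G` the ground set without `e`. Hence the
spectrum polynomial is the sum over `W` of `t ^ rk W * q ^ |G \ W|` times the formal spectrum of the
down-Laplacian on that block (`IsStratified.spectrumPolynomial_eq`).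

Deletion, contraction and reduction at `f` are stratified by the flats of `M` as well. So the defect
of the recursion, for the faces spanned by a flat `U` containing `f`, is the sum over `W ⊆ U` of `t
^ rk W * q ^ |U \ W|` times a quantity `stratumDefect` that does not depend on `U`
(`recursion_defect_eq_sum`).

At `t = -1` the recursion holds for every interval: nonzero eigenvalues cancel between adjacent
dimensions, the spectrum polynomial becomes an Euler characteristic, and the identity is elementary
(`eval_neg_one_recursion`). By induction on `U`, the defects of proper subsets vanish, only the term
of `U` survives, and its value at `t = -1` forces it to vanish too (`stratumDefect_eq_zero`). Taking
`U` to be the whole ground set gives the theorem. -/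

namespace SpectralRecursion

/-! ### Formal spectra of matrices, computed from characteristic polynomials. -/

section SpectralSum

open Polynomial

variable {n m : Type*} [Fintype n] [DecidableEq n] [Fintype m] [DecidableEq m]

/-- The formal sum `∑ q ^ l` over the eigenvalues `l` of a square matrix. -/
noncomputable def spectralSum (A : Matrix n n ℝ) : AddMonoidAlgebra ℤ ℝ :=
  (A.charpoly.roots.map qPow).sum

lemma qPow_zero : qPow 0 = 1 := rfl

lemma qPow_add (a b : ℝ) : qPow (a + b) = qPow a * qPow b := by
  simp [qPow, AddMonoidAlgebra.single_mul_single]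

lemma spectralSum_of_isEmpty [IsEmpty n] (A : Matrix n n ℝ) : spectralSum A = 0 := by
  simp [spectralSum, Matrix.charpoly, Matrix.det_isEmpty]

lemma spectralSum_reindex (e : n ≃ m) (A : Matrix n n ℝ) :
    spectralSum (Matrix.reindex e e A) = spectralSum A := by
  rw [spectralSum, Matrix.charpoly_reindex, spectralSum]

lemma spectralSum_add_scalar (A : Matrix n n ℝ) (c : ℝ) :
    spectralSum (A + Matrix.scalar n c) = qPow c * spectralSum A := by
  have h := Matrix.charpoly_sub_scalar A (-c)
  rw [map_neg, sub_neg_eq_add] at h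
  have hr := A.charpoly.map_roots_comp_C_mul_X_add_C 1 (-c) isUnit_one
  rw [C_1, one_mul] at hr
  rw [spectralSum, spectralSum, h, ← hr, Multiset.map_map, ← Multiset.sum_map_mul_left]
  congr 2
  funext x
  simp [← qPow_add]

/-- `A * B` and `B * A` have the same nonzero eigenvalues; the cardinalities balance the zero
eigenvalues, each of which counts `q ^ 0 = 1`. -/
lemma spectralSum_mul_comm (A : Matrix m n ℝ) (B : Matrix n m ℝ) :
    (Fintype.card n : AddMonoidAlgebra ℤ ℝ) + spectralSum (A * B)
      = Fintype.card m + spectralSum (B * A) := by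
  have h := congrArg (fun p => (p.roots.map qPow).sum) (Matrix.charpoly_mul_comm' A B)
  have h1 : (X ^ Fintype.card n * (A * B).charpoly) ≠ 0 :=
    ((monic_X_pow _).mul (Matrix.charpoly_monic _)).ne_zero
  have h2 : (X ^ Fintype.card m * (B * A).charpoly) ≠ 0 :=
    ((monic_X_pow _).mul (Matrix.charpoly_monic _)).ne_zero
  simpa [roots_mul h1, roots_mul h2, Multiset.map_nsmul, Multiset.sum_nsmul, qPow_zero,
    spectralSum] using h

/-- Since `A * B = 0`, `(X - A) * (X - B) = X * (X - (A + B))`; take determinants. -/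
lemma spectralSum_add_of_mul_eq_zero (A B : Matrix n n ℝ) (h : A * B = 0) :
    (Fintype.card n : AddMonoidAlgebra ℤ ℝ) + spectralSum (A + B)
      = spectralSum A + spectralSum B := by
  have hp : X ^ Fintype.card n * (A + B).charpoly = A.charpoly * B.charpoly := by
    have hAB : A.map (C : ℝ →+* ℝ[X]) * B.map (C : ℝ →+* ℝ[X]) = 0 := by
      rw [← Matrix.map_mul, h]; simp
    simp only [Matrix.charpoly, ← Matrix.det_mul, Matrix.charmatrix]
    rw [← Matrix.det_smul]
    congr 1
    simp only [sub_mul, mul_sub, RingHom.mapMatrix_apply, hAB]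
    refine Matrix.ext fun i j => ?_
    by_cases hij : i = j <;> simp [hij] <;> ring
  have h' := congrArg (fun p => (p.roots.map qPow).sum) hp
  have h1 : (X ^ Fintype.card n * (A + B).charpoly) ≠ 0 :=
    ((monic_X_pow _).mul (Matrix.charpoly_monic _)).ne_zero
  have h2 : A.charpoly * B.charpoly ≠ 0 :=
    ((Matrix.charpoly_monic _).mul (Matrix.charpoly_monic _)).ne_zero
  simpa [roots_mul h1, roots_mul h2, Multiset.map_nsmul, Multiset.sum_nsmul, qPow_zero,
    spectralSum] using h'

lemma spectralSum_eq_sum_blocks {β : Type*} [DecidableEq β] (A : Matrix n n ℝ) (b : n → β)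
    (h : ∀ i j, b i ≠ b j → A i j = 0) (s : Finset β) (hs : ∀ i, b i ∈ s) :
    spectralSum A = ∑ W ∈ s, spectralSum (A.toSquareBlock b W) := by
  have hb : A.charpoly = ∏ W ∈ Finset.univ.image b, (A.toSquareBlock b W).charpoly := by
    classical
    -- The entries vanish on both sides of the diagonal blocks, so any linear order on the labels
    -- makes the matrix block triangular.
    let o : LinearOrder β := linearOrderOfSTO WellOrderingRel
    have ht : A.BlockTriangular b := fun i j hij => h i j hij.ne'
    convert ht.charpoly
  have hs' : Finset.univ.image b ⊆ s := by
    intro W hW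
    obtain ⟨i, -, rfl⟩ := Finset.mem_image.1 hW
    exact hs i
  rw [← Finset.sum_subset hs' fun W _ hW => ?_]
  · rw [spectralSum, hb, roots_prod _ _ (Finset.prod_ne_zero_iff.2 fun W _ =>
      (Matrix.charpoly_monic _).ne_zero)]
    simp only [Multiset.map_bind, Multiset.sum_bind]
    rfl
  · have : IsEmpty {i // b i = W} := ⟨fun i => hW (by simpa using ⟨i.1, i.2⟩)⟩
    exact spectralSum_of_isEmpty _

end SpectralSum

/-! ### Sign identities for the boundary map. -/

section Incidence

variable {α : Type*} [LinearOrder α]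

lemma incidence_erase {G : Finset α} {v : α} (hv : v ∈ G) :
    incidence (G.erase v) G = (-1) ^ (G.filter fun w => w < v).card := by
  rw [incidence, Finset.sum_eq_single_of_mem v hv fun w hw hwv => if_neg fun h => ?_, if_pos rfl]
  exact Finset.notMem_erase v G (h ▸ Finset.mem_erase.2 ⟨hwv.symm, hv⟩)

lemma exists_eq_erase_of_incidence_ne_zero {F G : Finset α} (h : incidence F G ≠ 0) :
    ∃ v ∈ G, F = G.erase v := by
  contrapose! h
  exact Finset.sum_eq_zero fun v hv => if_neg (h v hv)

lemma incidence_erase_mul_self {G : Finset α} {v : α} (hv : v ∈ G) :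
    incidence (G.erase v) G * incidence (G.erase v) G = 1 := by
  rw [incidence_erase hv, ← mul_pow]; simp

lemma incidence_insert_mul_self {F : Finset α} {v : α} (hv : v ∉ F) :
    incidence F (insert v F) * incidence F (insert v F) = 1 := by
  have := incidence_erase_mul_self (Finset.mem_insert_self v F)
  rwa [Finset.erase_insert hv] at this

/-- The two ways of removing two vertices from a face carry opposite signs. -/
lemma incidence_erase_erase {G : Finset α} {v w : α} (hv : v ∈ G) (hw : w ∈ G) (hvw : v ≠ w) :
    incidence ((G.erase v).erase w) (G.erase v) * incidence (G.erase v) G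
      + incidence ((G.erase w).erase v) (G.erase w) * incidence (G.erase w) G = 0 := by
  wlog h : v < w generalizing v w
  · rw [add_comm]
    exact this hw hv hvw.symm (lt_of_le_of_ne (not_lt.1 h) hvw.symm)
  rw [incidence_erase hv, incidence_erase hw, incidence_erase (Finset.mem_erase.2 ⟨hvw.symm, hw⟩),
    incidence_erase (Finset.mem_erase.2 ⟨hvw, hv⟩)]
  have h1 : ((G.erase v).filter fun u => u < w) = (G.filter fun u => u < w).erase v := by
    ext u; simp; tauto
  have h2 : ((G.erase w).filter fun u => u < v) = G.filter fun u => u < v := by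
    ext u
    simp only [Finset.mem_filter, Finset.mem_erase]
    exact ⟨fun hu => ⟨hu.1.2, hu.2⟩, fun hu => ⟨⟨(hu.2.trans h).ne, hu.1⟩, hu.2⟩⟩
  rw [h1, h2, ← Finset.card_erase_add_one (Finset.mem_filter.2 ⟨hv, h⟩ :
    v ∈ G.filter fun u => u < w)]
  ring

/-- The contributions to a Laplacian entry of the common facet and the common cofacet of two
adjacent faces cancel. -/
lemma incidence_facet_add_cofacet {F : Finset α} {a b : α} (ha : a ∈ F) (hb : b ∉ F) :
    incidence F (insert b F) * incidence (insert b (F.erase a)) (insert b F)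
      + incidence (F.erase a) F * incidence (F.erase a) (insert b (F.erase a)) = 0 := by
  have hab : a ≠ b := fun h => hb (h ▸ ha)
  have hb' : b ∉ F.erase a := fun h => hb (Finset.mem_of_mem_erase h)
  have h := incidence_erase_erase (Finset.mem_insert_self b F) (Finset.mem_insert_of_mem ha)
    hab.symm
  rw [Finset.erase_insert hb, Finset.erase_insert_of_ne hab.symm, Finset.erase_insert hb'] at h
  have h1 := incidence_insert_mul_self hb
  have h2 := incidence_insert_mul_self hb'
  linear_combination (incidence F (insert b F) * incidence (F.erase a) (insert b (F.erase a))) * h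
    - incidence (F.erase a) F * incidence (F.erase a) (insert b (F.erase a)) * h1
    - incidence F (insert b F) * incidence (insert b (F.erase a)) (insert b F) * h2

/-- A nonzero term forces `F = H - v - w`. The only two faces in between belong to `Φ` by convexity,
and their terms cancel. -/
lemma sum_incidence_mul_incidence (Φ : Finset (Finset α)) {F H : Finset α} (hF : F ∈ Φ)
    (hH : H ∈ Φ) (hΦ : ∀ F ∈ Φ, ∀ H ∈ Φ, ∀ G : Finset α, F ⊆ G → G ⊆ H → G ∈ Φ) :
    ∑ G ∈ Φ, incidence F G * incidence G H = 0 := by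
  by_cases h : ∀ G ∈ Φ, incidence F G * incidence G H = 0
  · exact Finset.sum_eq_zero h
  push Not at h
  obtain ⟨G, -, hG⟩ := h
  obtain ⟨v, hv, rfl⟩ := exists_eq_erase_of_incidence_ne_zero (right_ne_zero_of_mul hG)
  obtain ⟨w, hw, rfl⟩ := exists_eq_erase_of_incidence_ne_zero (left_ne_zero_of_mul hG)
  obtain ⟨hwv, hw⟩ := Finset.mem_erase.1 hw
  have hvΦ : H.erase v ∈ Φ := hΦ _ hF _ hH _ (Finset.erase_subset _ _) (Finset.erase_subset _ _)
  have hwΦ : H.erase w ∈ Φ := hΦ _ hF _ hH _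
    (by rw [Finset.erase_right_comm]; exact Finset.erase_subset _ _) (Finset.erase_subset _ _)
  have hne : H.erase v ≠ H.erase w := fun h =>
    Finset.notMem_erase w H (h ▸ Finset.mem_erase.2 ⟨hwv, hw⟩)
  rw [← Finset.sum_subset (s₁ := {H.erase v, H.erase w}) (by
    intro G hG
    rcases Finset.mem_insert.1 hG with rfl | hG
    · exact hvΦ
    · rwa [Finset.mem_singleton.1 hG]) ?_, Finset.sum_pair hne]
  · have h := incidence_erase_erase hv hw hwv.symm
    rwa [Finset.erase_right_comm (s := H) (a := w) (b := v)] at h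
  · intro G _ hG
    by_contra hne0
    obtain ⟨x, hx, rfl⟩ := exists_eq_erase_of_incidence_ne_zero (right_ne_zero_of_mul hne0)
    obtain ⟨y, hy, hxy⟩ := exists_eq_erase_of_incidence_ne_zero (left_ne_zero_of_mul hne0)
    refine hG ?_
    have hx' : x ∉ (H.erase v).erase w := by rw [hxy]; simp
    rw [Finset.mem_insert, Finset.mem_singleton]
    by_cases hxw : x = w
    · right; rw [hxw]
    by_cases hxv : x = v
    · left; rw [hxv]
    exact (hx' (Finset.mem_erase.2 ⟨hxw, Finset.mem_erase.2 ⟨hxv, hx⟩⟩)).elim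

end Incidence

/-! ### The spectrum polynomial at `t = -1`. -/

section McKeanSinger

variable {α : Type*} [LinearOrder α]

lemma mem_faces {α : Type*} {Φ : Finset (Finset α)} {i : ℤ} {F : Finset α} :
    F ∈ faces Φ i ↔ F ∈ Φ ∧ (F.card : ℤ) - 1 = i := Finset.mem_filter

/-- Sums over a layer of faces of terms that vanish off the layer are sums over the family. -/
lemma sum_faces {α : Type*} {Φ : Finset (Finset α)} {i : ℤ} (g : Finset α → ℝ)
    (hg : ∀ G ∈ Φ, (G.card : ℤ) - 1 ≠ i → g G = 0) :
    ∑ G : faces Φ i, g G.1 = ∑ G ∈ Φ, g G := by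
  rw [Finset.sum_coe_sort (faces Φ i) g]
  refine Finset.sum_subset (Finset.filter_subset _ _) fun G hG hGi => hg G hG fun h => ?_
  exact hGi (mem_faces.2 ⟨hG, h⟩)

lemma incidence_eq_zero_of_card_ne {F G : Finset α} (h : F.card + 1 ≠ G.card) :
    incidence F G = 0 := by
  by_contra h0
  obtain ⟨v, hv, rfl⟩ := exists_eq_erase_of_incidence_ne_zero h0
  exact h (Finset.card_erase_add_one hv)

lemma boundary_mul_boundary (Φ : Finset (Finset α)) (i : ℤ)
    (hΦ : ∀ F ∈ Φ, ∀ H ∈ Φ, ∀ G : Finset α, F ⊆ G → G ⊆ H → G ∈ Φ) :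
    boundary Φ (i - 1) i * boundary Φ i (i + 1) = 0 := by
  ext F H
  obtain ⟨hF, hFi⟩ := mem_faces.1 F.2
  obtain ⟨hH, hHi⟩ := mem_faces.1 H.2
  simp only [Matrix.mul_apply, boundary, Matrix.of_apply, Matrix.zero_apply]
  rw [sum_faces (fun G => incidence F.1 G * incidence G H.1),
    sum_incidence_mul_incidence Φ hF hH hΦ]
  intro G _ hG
  rw [incidence_eq_zero_of_card_ne (by omega), zero_mul]

/-- The formal spectrum of the up-Laplacian on the faces of dimension `i`. -/
noncomputable def upSum (Φ : Finset (Finset α)) (i : ℤ) : AddMonoidAlgebra ℤ ℝ :=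
  spectralSum (boundary Φ i (i + 1) * (boundary Φ i (i + 1))ᵀ)

/-- The up and down parts annihilate each other because `∂∂ = 0`, so their spectra add up to zeros.
Swapping the factors of the down part turns it into the up part one dimension lower. -/
lemma spectralSum_laplacian (Φ : Finset (Finset α)) (i : ℤ)
    (hΦ : ∀ F ∈ Φ, ∀ H ∈ Φ, ∀ G : Finset α, F ⊆ G → G ⊆ H → G ∈ Φ) :
    spectralSum (laplacian Φ i) =
      upSum Φ i + upSum Φ (i - 1) - ((faces Φ (i - 1)).card : AddMonoidAlgebra ℤ ℝ) := by
  have h1 := spectralSum_add_of_mul_eq_zero (boundary Φ i (i + 1) * (boundary Φ i (i + 1))ᵀ)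
    ((boundary Φ (i - 1) i)ᵀ * boundary Φ (i - 1) i) (by
      have h := congrArg Matrix.transpose (boundary_mul_boundary Φ i hΦ)
      rw [Matrix.transpose_mul, Matrix.transpose_zero] at h
      rw [Matrix.mul_assoc, ← Matrix.mul_assoc _ᵀ, h]
      simp)
  -- The up part in dimension `i - 1` has its columns indexed by `i - 1 + 1`, which is only
  -- propositionally `i`; hence the auxiliary `k`.
  have h2 : ∀ k, k = i → ((faces Φ k).card : AddMonoidAlgebra ℤ ℝ)
      + spectralSum (boundary Φ (i - 1) k * (boundary Φ (i - 1) k)ᵀ)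
      = (faces Φ (i - 1)).card + spectralSum ((boundary Φ (i - 1) i)ᵀ * boundary Φ (i - 1) i) := by
    rintro k rfl
    simpa using spectralSum_mul_comm (boundary Φ (k - 1) k) (boundary Φ (k - 1) k)ᵀ
  have h2 := h2 (i - 1 + 1) (by ring)
  rw [show (faces Φ (i - 1 + 1)).card = (faces Φ i).card by rw [sub_add_cancel]] at h2
  rw [Fintype.card_coe] at h1
  rw [laplacian, upSum, upSum]
  linear_combination h1 - h2

lemma isEmpty_faces {α : Type*} {Φ : Finset (Finset α)} {i : ℤ} (h : ∀ F ∈ Φ, (F.card : ℤ) - 1 ≠ i) :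
    IsEmpty (faces Φ i) :=
  ⟨fun F => h F.1 (mem_faces.1 F.2).1 (mem_faces.1 F.2).2⟩

lemma upSum_eq_zero {Φ : Finset (Finset α)} {i : ℤ} (h : ∀ F ∈ Φ, (F.card : ℤ) - 1 ≠ i) :
    upSum Φ i = 0 :=
  have := isEmpty_faces h
  spectralSum_of_isEmpty _

lemma card_faces_eq_zero {α : Type*} {Φ : Finset (Finset α)} {i : ℤ} (h : ∀ F ∈ Φ, (F.card : ℤ) - 1 ≠ i) :
    (faces Φ i).card = 0 := by
  have := isEmpty_faces h
  rw [← Fintype.card_coe, Fintype.card_eq_zero]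

/-- Each up-spectrum occurs in two consecutive Laplacians with opposite signs, so the sum telescopes
to face counts and one boundary term. -/
lemma sum_range_spectralSum_laplacian (Φ : Finset (Finset α))
    (hΦ : ∀ F ∈ Φ, ∀ H ∈ Φ, ∀ G : Finset α, F ⊆ G → G ⊆ H → G ∈ Φ) (N : ℕ) :
    ∑ k ∈ Finset.range N, (-1) ^ k * spectralSum (laplacian Φ ((k : ℤ) - 1)) =
      ∑ k ∈ Finset.range N, (-1) ^ k * ((faces Φ ((k : ℤ) - 1)).card : AddMonoidAlgebra ℤ ℝ)
      - (-1) ^ N * (upSum Φ ((N : ℤ) - 1 - 1) - (faces Φ ((N : ℤ) - 1 - 1)).card) := by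
  induction N with
  | zero =>
    have h : ∀ F ∈ Φ, (F.card : ℤ) - 1 ≠ ((0 : ℕ) : ℤ) - 1 - 1 := fun F _ => by omega
    simp only [Finset.range_zero, Finset.sum_empty, upSum_eq_zero h, card_faces_eq_zero h]
    simp
  | succ N ih =>
    rw [Finset.sum_range_succ, Finset.sum_range_succ, ih, spectralSum_laplacian Φ _ hΦ,
      show ((N + 1 : ℕ) : ℤ) - 1 - 1 = (N : ℤ) - 1 by push_cast; ring]
    ring

/-- The reduced Euler characteristic, up to sign, of a family of faces. -/
noncomputable def eulerChar (Φ : Finset (Finset α)) : AddMonoidAlgebra ℤ ℝ :=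
  ∑ F ∈ Φ, (-1) ^ F.card

lemma eval_neg_one_spectrumPolynomial (Φ : Finset (Finset α))
    (hΦ : ∀ F ∈ Φ, ∀ H ∈ Φ, ∀ G : Finset α, F ⊆ G → G ⊆ H → G ∈ Φ) :
    (spectrumPolynomial Φ).eval (-1) = eulerChar Φ := by
  obtain ⟨N, hN⟩ : ∃ N, ∀ F ∈ Φ, F.card < N :=
    ⟨Φ.sup Finset.card + 1, fun F hF => Nat.lt_succ_of_le (Finset.le_sup hF)⟩
  have himg : Φ.image Finset.card ⊆ Finset.range (N + 1) := by
    intro k hk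
    obtain ⟨F, hF, rfl⟩ := Finset.mem_image.1 hk
    exact Finset.mem_range.2 ((hN F hF).trans (Nat.lt_succ_self N))
  have hzero : ∀ k ∉ Φ.image Finset.card, ∀ F ∈ Φ, (F.card : ℤ) - 1 ≠ (k : ℤ) - 1 :=
    fun k hk F hF h => hk (Finset.mem_image.2 ⟨F, hF, by omega⟩)
  -- Stopping at `N + 1` puts the boundary term in dimension `N - 1`, where there are no faces.
  have hS := sum_range_spectralSum_laplacian Φ hΦ (N + 1)
  have hlast : ∀ F ∈ Φ, (F.card : ℤ) - 1 ≠ ((N + 1 : ℕ) : ℤ) - 1 - 1 := fun F hF h => by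
    have := hN F hF
    push_cast at h
    omega
  rw [upSum_eq_zero hlast, card_faces_eq_zero hlast] at hS
  rw [spectrumPolynomial, Polynomial.eval_finsetSum]
  calc _ = ∑ k ∈ Φ.image Finset.card, (-1) ^ k * spectralSum (laplacian Φ ((k : ℤ) - 1)) :=
        Finset.sum_congr rfl fun k _ => by rw [Polynomial.eval_monomial, mul_comm]; rfl
    _ = ∑ k ∈ Finset.range (N + 1), (-1) ^ k * spectralSum (laplacian Φ ((k : ℤ) - 1)) :=
        Finset.sum_subset himg fun k _ hk => by
          have := isEmpty_faces (hzero k hk)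
          rw [spectralSum_of_isEmpty, mul_zero]
    _ = ∑ k ∈ Finset.range (N + 1),
          (-1) ^ k * ((faces Φ ((k : ℤ) - 1)).card : AddMonoidAlgebra ℤ ℝ) := by
        rw [hS]; simp
    _ = ∑ k ∈ Finset.range (N + 1), ∑ F ∈ Φ with F.card = k, (-1) ^ F.card := by
        refine Finset.sum_congr rfl fun k _ => ?_
        rw [show faces Φ ((k : ℤ) - 1) = Φ.filter fun F => F.card = k by
          ext F; simp [mem_faces], Finset.sum_congr rfl fun F hF => by
            rw [(Finset.mem_filter.1 hF).2], Finset.sum_const, nsmul_eq_mul, mul_comm]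
    _ = eulerChar Φ := Finset.sum_fiberwise_of_maps_to
        (fun F hF => himg (Finset.mem_image_of_mem _ hF)) _

end McKeanSinger

/-! ### Block decomposition of the Laplacian along closures. -/

section Strata

variable {α : Type*} [LinearOrder α]

/-- A family `Φ` of subsets of `G` with a closure map `κ` for which adding a vertex `v` to a face
`F` gives a face exactly if `v ∉ κ F`, and which has the exchange properties that make the
Laplacians block diagonal with respect to `κ`. -/
structure IsStratified (Φ : Finset (Finset α)) (κ : Finset α → Finset α) (G : Finset α) :
    Prop where
  subset_ground : ∀ F ∈ Φ, F ⊆ G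
  subset_closure : ∀ F ∈ Φ, F ⊆ κ F
  insert_mem : ∀ F ∈ Φ, ∀ v ∈ G, v ∉ κ F → insert v F ∈ Φ
  insert_notMem : ∀ F ∈ Φ, ∀ v ∈ κ F, v ∉ F → insert v F ∉ Φ
  erase_mem : ∀ F ∈ Φ, ∀ a ∈ F, ∀ b, b ∉ κ F → insert b (F.erase a) ∈ Φ → F.erase a ∈ Φ
  closure_exchange : ∀ F ∈ Φ, ∀ a ∈ F, ∀ b ∈ κ F, b ∉ F → insert b (F.erase a) ∈ Φ →
    κ (insert b (F.erase a)) = κ F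
  closure_erase : ∀ F ∈ Φ, ∀ a ∈ F, F.erase a ∈ Φ → κ (F.erase a) ⊆ κ F

/-- The matrix of the down-Laplacian of `Φ`, restricted to the faces in `S`. -/
def downMatrix (Φ S : Finset (Finset α)) : Matrix S S ℝ :=
  Matrix.of fun F F' => ∑ H ∈ Φ, incidence H F.1 * incidence H F'.1

/-- The formal spectrum of the down-Laplacian of `Φ` on the faces with closure `W`. -/
noncomputable def stratumSum (Φ : Finset (Finset α)) (κ : Finset α → Finset α) (W : Finset α) :
    AddMonoidAlgebra ℤ ℝ :=
  spectralSum (downMatrix Φ (Φ.filter fun F => κ F = W))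

lemma stratumSum_eq_zero {Φ : Finset (Finset α)} {κ : Finset α → Finset α} {W : Finset α}
    (h : ∀ F ∈ Φ, κ F ≠ W) : stratumSum Φ κ W = 0 := by
  have : IsEmpty (Φ.filter fun F => κ F = W) :=
    ⟨fun F => h F.1 (Finset.mem_filter.1 F.2).1 (Finset.mem_filter.1 F.2).2⟩
  exact spectralSum_of_isEmpty _

lemma laplacian_apply (Φ : Finset (Finset α)) (i : ℤ) (F F' : faces Φ i) :
    laplacian Φ i F F' = ∑ T ∈ Φ, incidence F.1 T * incidence F'.1 T
      + ∑ H ∈ Φ, incidence H F.1 * incidence H F'.1 := by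
  have hF := (mem_faces.1 F.2).2
  simp only [laplacian, Matrix.add_apply, Matrix.mul_apply, Matrix.transpose_apply, boundary,
    Matrix.of_apply]
  rw [sum_faces (fun T => incidence F.1 T * incidence F'.1 T) fun T _ hT => ?_,
    sum_faces (fun H => incidence H F.1 * incidence H F'.1) fun H _ hH => ?_]
  · rw [incidence_eq_zero_of_card_ne (by omega), zero_mul]
  · rw [incidence_eq_zero_of_card_ne (by omega), zero_mul]

lemma exists_exchange_of_cofacet {F F' T : Finset α} (hne : F ≠ F')
    (h : incidence F T * incidence F' T ≠ 0) :
    ∃ a ∈ F, ∃ b, b ∉ F ∧ F' = insert b (F.erase a) ∧ T = insert b F := by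
  obtain ⟨b, hb, rfl⟩ := exists_eq_erase_of_incidence_ne_zero (left_ne_zero_of_mul h)
  obtain ⟨a, ha, rfl⟩ := exists_eq_erase_of_incidence_ne_zero (right_ne_zero_of_mul h)
  have hab : a ≠ b := fun h => hne (by rw [h])
  refine ⟨a, Finset.mem_erase.2 ⟨hab, ha⟩, b, Finset.notMem_erase _ _, ?_,
    (Finset.insert_erase hb).symm⟩
  rw [Finset.erase_right_comm, Finset.insert_erase (Finset.mem_erase.2 ⟨hab.symm, hb⟩)]

lemma exists_exchange_of_facet {F F' H : Finset α} (hne : F ≠ F')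
    (h : incidence H F * incidence H F' ≠ 0) :
    ∃ a ∈ F, ∃ b, b ∉ F ∧ F' = insert b (F.erase a) ∧ H = F.erase a := by
  obtain ⟨a, ha, rfl⟩ := exists_eq_erase_of_incidence_ne_zero (left_ne_zero_of_mul h)
  obtain ⟨b, hb, hab⟩ := exists_eq_erase_of_incidence_ne_zero (right_ne_zero_of_mul h)
  refine ⟨a, ha, b, fun hbF => hne ?_, by rw [hab, Finset.insert_erase hb], rfl⟩
  have hba : b = a := by
    by_contra hba
    exact Finset.notMem_erase b F' (hab ▸ Finset.mem_erase.2 ⟨hba, hbF⟩)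
  subst hba
  rw [← Finset.insert_erase ha, hab, Finset.insert_erase hb]

/-- Ensures that two adjacent faces have only one candidate for a common facet and one for a common
cofacet. -/
lemma exchange_unique {F : Finset α} {a b c d : α} (hb : b ∉ F) (hd : d ∉ F)
    (hc : c ∈ F) (h : insert b (F.erase a) = insert d (F.erase c)) : a = c ∧ b = d := by
  have hbd : b = d := by
    have : b ∈ insert d (F.erase c) := h ▸ Finset.mem_insert_self _ _
    rcases Finset.mem_insert.1 this with h | h
    · exact h
    · exact (hb (Finset.mem_of_mem_erase h)).elim
  refine ⟨?_, hbd⟩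
  by_contra hac
  have : c ∈ insert d (F.erase c) := h ▸ Finset.mem_insert_of_mem
    (Finset.mem_erase.2 ⟨Ne.symm hac, hc⟩)
  rcases Finset.mem_insert.1 this with h | h
  · exact hd (h ▸ hc)
  · exact Finset.notMem_erase _ _ h

namespace IsStratified

variable {Φ : Finset (Finset α)} {κ : Finset α → Finset α} {G : Finset α}

/-- The cofacets of `F` correspond to the vertices of `G` outside `κ F`, and each contributes the
square of a sign. -/
lemma sum_cofacet_self (h : IsStratified Φ κ G) {F : Finset α} (hF : F ∈ Φ) :
    ∑ T ∈ Φ, incidence F T * incidence F T = ((G \ κ F).card : ℝ) := by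
  have hinj : Set.InjOn (fun v => insert v F) (G \ κ F : Finset α) := by
    intro v hv w _ hvw
    have hvF : v ∉ F := fun hvF =>
      (Finset.mem_sdiff.1 hv).2 (h.subset_closure F hF hvF)
    have : v ∈ insert w F := by
      rw [← show insert v F = insert w F from hvw]; exact Finset.mem_insert_self _ _
    exact (Finset.mem_insert.1 this).resolve_right hvF
  have hsub : (G \ κ F).image (fun v => insert v F) ⊆ Φ := by
    intro T hT
    obtain ⟨v, hv, rfl⟩ := Finset.mem_image.1 hT
    exact h.insert_mem F hF v (Finset.mem_sdiff.1 hv).1 (Finset.mem_sdiff.1 hv).2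
  rw [← Finset.sum_subset hsub, Finset.sum_image hinj]
  · rw [Finset.sum_congr rfl fun v hv => incidence_insert_mul_self fun hvF =>
      (Finset.mem_sdiff.1 hv).2 (h.subset_closure F hF hvF)]
    simp
  · intro T hT hTF
    by_contra h0
    obtain ⟨v, hv, rfl⟩ := exists_eq_erase_of_incidence_ne_zero (left_ne_zero_of_mul h0)
    refine hTF (Finset.mem_image.2 ⟨v, Finset.mem_sdiff.2 ⟨h.subset_ground T hT hv, fun hvκ => ?_⟩,
      Finset.insert_erase hv⟩)
    refine h.insert_notMem _ hF v hvκ (Finset.notMem_erase _ _) ?_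
    rwa [Finset.insert_erase hv]

/-- A common cofacet would be `F` with a vertex of `F' ⊆ κ F' = κ F` added, which `insert_notMem`
excludes. -/
lemma sum_cofacet_of_closure_eq (h : IsStratified Φ κ G) {F F' : Finset α} (hF : F ∈ Φ)
    (hF' : F' ∈ Φ) (hne : F ≠ F') (hκ : κ F = κ F') :
    ∑ T ∈ Φ, incidence F T * incidence F' T = 0 := by
  refine Finset.sum_eq_zero fun T hT => ?_
  by_contra h0
  obtain ⟨a, -, b, hb, rfl, rfl⟩ := exists_exchange_of_cofacet hne h0
  refine h.insert_notMem F hF b ?_ hb hT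
  rw [hκ]
  exact h.subset_closure _ hF' (Finset.mem_insert_self _ _)

/-- If `F'` is `F - a + b`, then `b ∉ κ F`, for otherwise the closures would agree. So both `F + b`
and `F - a` are faces and their contributions cancel. Without such an exchange there is neither a
common facet nor a common cofacet. -/
lemma sum_cofacet_add_sum_facet (h : IsStratified Φ κ G) {F F' : Finset α} (hF : F ∈ Φ)
    (hF' : F' ∈ Φ) (hκ : κ F ≠ κ F') :
    ∑ T ∈ Φ, incidence F T * incidence F' T + ∑ H ∈ Φ, incidence H F * incidence H F' = 0 := by
  have hne : F ≠ F' := fun h => hκ (by rw [h])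
  by_cases hex : ∃ a ∈ F, ∃ b, b ∉ F ∧ F' = insert b (F.erase a)
  · obtain ⟨a, ha, b, hb, rfl⟩ := hex
    have hbκ : b ∉ κ F := fun hbκ => hκ (h.closure_exchange F hF a ha b hbκ hb hF').symm
    have hT := h.insert_mem F hF b (h.subset_ground _ hF' (Finset.mem_insert_self _ _)) hbκ
    have hH := h.erase_mem F hF a ha b hbκ hF'
    rw [Finset.sum_eq_single_of_mem _ hT fun T _ hTne => ?_,
      Finset.sum_eq_single_of_mem _ hH fun H _ hHne => ?_]
    · exact incidence_facet_add_cofacet ha hb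
    · by_contra h0
      obtain ⟨c, hc, d, hd, hcd, rfl⟩ := exists_exchange_of_facet hne h0
      exact hHne (by rw [(exchange_unique hb hd hc hcd).1])
    · by_contra h0
      obtain ⟨c, hc, d, hd, hcd, rfl⟩ := exists_exchange_of_cofacet hne h0
      exact hTne (by rw [(exchange_unique hb hd hc hcd).2])
  · rw [Finset.sum_eq_zero, Finset.sum_eq_zero, add_zero]
    · intro H _
      by_contra h0
      obtain ⟨a, ha, b, hb, hab, -⟩ := exists_exchange_of_facet hne h0
      exact hex ⟨a, ha, b, hb, hab⟩
    · intro T _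
      by_contra h0
      obtain ⟨a, ha, b, hb, hab, -⟩ := exists_exchange_of_cofacet hne h0
      exact hex ⟨a, ha, b, hb, hab⟩

lemma spectralSum_laplacian_stratum (h : IsStratified Φ κ G) (ρ : Finset α → ℕ)
    (hρ : ∀ F ∈ Φ, F.card = ρ (κ F)) (k : ℕ) (W : Finset α) :
    spectralSum ((laplacian Φ ((k : ℤ) - 1)).toSquareBlock (fun F => κ F.1) W) =
      if ρ W = k then qPow (G \ W).card * stratumSum Φ κ W else 0 := by
  split_ifs with hk
  · let ε : {F : faces Φ ((k : ℤ) - 1) // κ F.1 = W} ≃ (Φ.filter fun F => κ F = W) :=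
      { toFun := fun F => ⟨F.1.1, Finset.mem_filter.2 ⟨(mem_faces.1 F.1.2).1, F.2⟩⟩
        invFun := fun F => ⟨⟨F.1, mem_faces.2 ⟨(Finset.mem_filter.1 F.2).1, by
          rw [hρ _ (Finset.mem_filter.1 F.2).1, (Finset.mem_filter.1 F.2).2, hk]⟩⟩,
          (Finset.mem_filter.1 F.2).2⟩
        left_inv := fun _ => rfl
        right_inv := fun _ => rfl }
    rw [stratumSum, ← spectralSum_add_scalar, ← spectralSum_reindex ε]
    congr 1
    ext F F'
    obtain ⟨hF, hFW⟩ := Finset.mem_filter.1 F.2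
    obtain ⟨hF', hFW'⟩ := Finset.mem_filter.1 F'.2
    have hL : Matrix.reindex ε ε ((laplacian Φ ((k : ℤ) - 1)).toSquareBlock (fun F => κ F.1) W)
        F F' = ∑ T ∈ Φ, incidence F.1 T * incidence F'.1 T
          + ∑ H ∈ Φ, incidence H F.1 * incidence H F'.1 := laplacian_apply _ _ _ _
    rw [hL, add_comm, Matrix.add_apply]
    refine congrArg₂ (· + ·) rfl ?_
    by_cases hFF : F = F'
    · subst hFF
      rw [h.sum_cofacet_self hF, hFW, Matrix.scalar_apply, Matrix.diagonal_apply_eq]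
    · rw [h.sum_cofacet_of_closure_eq hF hF' (fun h => hFF (Subtype.ext h)) (hFW.trans hFW'.symm),
        Matrix.scalar_apply, Matrix.diagonal_apply_ne _ hFF]
  · have : IsEmpty {F : faces Φ ((k : ℤ) - 1) // κ F.1 = W} := by
      refine ⟨fun F => hk ?_⟩
      obtain ⟨hF, hFk⟩ := mem_faces.1 F.1.2
      have := hρ _ hF
      rw [F.2] at this
      omega
    exact spectralSum_of_isEmpty _

/-- The spectrum polynomial of a stratified family is a sum over the strata. -/
theorem spectrumPolynomial_eq (h : IsStratified Φ κ G) (ρ : Finset α → ℕ)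
    (hρ : ∀ F ∈ Φ, F.card = ρ (κ F)) (s : Finset (Finset α)) (hs : ∀ F ∈ Φ, κ F ∈ s) :
    spectrumPolynomial Φ =
      ∑ W ∈ s, Polynomial.monomial (ρ W) (qPow (G \ W).card * stratumSum Φ κ W) := by
  have hk : ∀ k : ℕ, ((eigenvalues Φ ((k : ℤ) - 1)).map qPow).sum =
      ∑ W ∈ s, if ρ W = k then qPow (G \ W).card * stratumSum Φ κ W else 0 := by
    intro k
    change spectralSum (laplacian Φ ((k : ℤ) - 1)) = _
    rw [spectralSum_eq_sum_blocks _ (fun F => κ F.1) ?_ s fun F => hs _ (mem_faces.1 F.2).1]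
    · exact Finset.sum_congr rfl fun W _ => h.spectralSum_laplacian_stratum ρ hρ k W
    · intro F F' hFF
      rw [laplacian_apply]
      exact h.sum_cofacet_add_sum_facet (mem_faces.1 F.2).1 (mem_faces.1 F'.2).1 hFF
  simp only [spectrumPolynomial, hk, map_sum]
  rw [Finset.sum_comm]
  refine Finset.sum_congr rfl fun W _ => ?_
  by_cases hW : ∃ F ∈ Φ, κ F = W
  · obtain ⟨F, hF, rfl⟩ := hW
    rw [Finset.sum_eq_single_of_mem (ρ (κ F)) (Finset.mem_image.2 ⟨F, hF, hρ F hF⟩), if_pos rfl]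
    intro k _ hk
    rw [if_neg hk.symm, map_zero]
  -- For an empty stratum `ρ W` need not be the size of any face, but the coefficient is zero.
  · push Not at hW
    simp [stratumSum_eq_zero hW]

/-- The subfamily of the faces whose closure lies in a closed set is stratified. -/
lemma restrict (h : IsStratified Φ κ G) {U : Finset α}
    (hU : ∀ F ∈ Φ, F ⊆ U → κ F ⊆ U) :
    IsStratified (Φ.filter fun F => κ F ⊆ U) κ (G ∩ U) where
  subset_ground F hF := by
    obtain ⟨hF, hFU⟩ := Finset.mem_filter.1 hF
    exact Finset.subset_inter (h.subset_ground F hF) ((h.subset_closure F hF).trans hFU)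
  subset_closure F hF := h.subset_closure F (Finset.mem_filter.1 hF).1
  insert_mem F hF v hv hvF := by
    obtain ⟨hF, hFU⟩ := Finset.mem_filter.1 hF
    obtain ⟨hvG, hvU⟩ := Finset.mem_inter.1 hv
    have hi := h.insert_mem F hF v hvG hvF
    exact Finset.mem_filter.2 ⟨hi, hU _ hi
      (Finset.insert_subset hvU ((h.subset_closure F hF).trans hFU))⟩
  insert_notMem F hF v hv hvF hi :=
    h.insert_notMem F (Finset.mem_filter.1 hF).1 v hv hvF (Finset.mem_filter.1 hi).1
  erase_mem F hF a ha b hb hi := by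
    obtain ⟨hF, hFU⟩ := Finset.mem_filter.1 hF
    have he := h.erase_mem F hF a ha b hb (Finset.mem_filter.1 hi).1
    exact Finset.mem_filter.2 ⟨he, (h.closure_erase F hF a ha he).trans hFU⟩
  closure_exchange F hF a ha b hb hbF hi :=
    h.closure_exchange F (Finset.mem_filter.1 hF).1 a ha b hb hbF (Finset.mem_filter.1 hi).1
  closure_erase F hF a ha he :=
    h.closure_erase F (Finset.mem_filter.1 hF).1 a ha (Finset.mem_filter.1 he).1

/-- Facets have smaller closure, so restricting to `U` loses no facet of a face in the stratum. This
is why the block of `W` does not depend on `U`. -/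
lemma stratumSum_restrict (h : IsStratified Φ κ G) {U W : Finset α} (hWU : W ⊆ U) :
    stratumSum (Φ.filter fun F => κ F ⊆ U) κ W = stratumSum Φ κ W := by
  have hS : ((Φ.filter fun F => κ F ⊆ U).filter fun F => κ F = W) =
      Φ.filter fun F => κ F = W := by
    rw [Finset.filter_filter]
    exact Finset.filter_congr fun F _ => ⟨fun h => h.2, fun h => ⟨h ▸ hWU, h⟩⟩
  rw [stratumSum, stratumSum, hS]
  congr 1
  ext F F'
  refine Finset.sum_subset (Finset.filter_subset _ _) fun H hH hHU => ?_
  by_contra h0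
  obtain ⟨hF, hFW⟩ := Finset.mem_filter.1 F.2
  obtain ⟨a, ha, rfl⟩ := exists_eq_erase_of_incidence_ne_zero (left_ne_zero_of_mul h0)
  exact hHU (Finset.mem_filter.2 ⟨hH, (h.closure_erase _ hF a ha hH).trans (hFW.subset.trans hWU)⟩)

/-- The spectrum polynomial of the faces with closure in `U`, as a sum over the strata. -/
theorem spectrumPolynomial_restrict (h : IsStratified Φ κ G) (ρ : Finset α → ℕ)
    (hρ : ∀ F ∈ Φ, F.card = ρ (κ F)) {U : Finset α} (hU : ∀ F ∈ Φ, F ⊆ U → κ F ⊆ U) :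
    spectrumPolynomial (Φ.filter fun F => κ F ⊆ U) =
      ∑ W ∈ U.powerset, Polynomial.monomial (ρ W)
        (qPow ((G ∩ U) \ W).card * stratumSum Φ κ W) := by
  rw [(h.restrict hU).spectrumPolynomial_eq ρ (fun F hF => hρ F (Finset.mem_filter.1 hF).1)
    U.powerset fun F hF => Finset.mem_powerset.2 (Finset.mem_filter.1 hF).2]
  exact Finset.sum_congr rfl fun W hW => by
    rw [h.stratumSum_restrict (Finset.mem_powerset.1 hW)]

end IsStratified

end Strata

/-! ### Euler characteristics and the recursion at `t = -1`. -/

section EulerCharacteristic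

variable {α : Type*} [LinearOrder α]

lemma mem_deletion {Φ : Finset (Finset α)} {f : α} {F : Finset α} :
    F ∈ deletion Φ f ↔ F ∈ Φ ∧ f ∉ F := Finset.mem_filter

lemma mem_contraction {Φ : Finset (Finset α)} {f : α} {F : Finset α} :
    F ∈ contraction Φ f ↔ f ∉ F ∧ insert f F ∈ Φ := by
  simp only [contraction, Finset.mem_image, Finset.mem_filter]
  constructor
  · rintro ⟨G, ⟨hG, hf⟩, rfl⟩
    exact ⟨Finset.notMem_erase _ _, by rwa [Finset.insert_erase hf]⟩
  · rintro ⟨hf, hF⟩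
    exact ⟨_, ⟨hF, Finset.mem_insert_self _ _⟩, Finset.erase_insert hf⟩

lemma mem_reduction {Φ : Finset (Finset α)} {f : α} {F : Finset α} :
    F ∈ reduction Φ f ↔ F ∈ Φ ∧ ¬ (F.erase f ∈ Φ ∧ insert f F ∈ Φ) := by
  simp only [reduction, star, Finset.mem_sdiff, Finset.mem_filter]
  tauto

lemma eulerChar_eq_deletion_sub_contraction (Φ : Finset (Finset α)) (f : α) :
    eulerChar Φ = eulerChar (deletion Φ f) - eulerChar (contraction Φ f) := by
  have hinj : Set.InjOn (fun F : Finset α => F.erase f) (Φ.filter fun F => f ∈ F) := by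
    intro F hF G hG h
    rw [← Finset.insert_erase (Finset.mem_filter.1 hF).2,
      ← Finset.insert_erase (Finset.mem_filter.1 hG).2]
    exact congrArg (insert f) h
  rw [eulerChar, ← Finset.sum_filter_not_add_sum_filter Φ (fun F => f ∈ F), eulerChar, eulerChar,
    deletion, contraction, Finset.sum_image hinj, sub_eq_add_neg, ← Finset.sum_neg_distrib]
  congr 1
  refine Finset.sum_congr rfl fun F hF => ?_
  rw [← Finset.card_erase_add_one (Finset.mem_filter.1 hF).2]
  ring

/-- Toggling `f` is a sign-reversing involution on the star. -/
lemma eulerChar_reduction (Φ : Finset (Finset α)) (f : α) :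
    eulerChar (reduction Φ f) = eulerChar Φ := by
  have hs : ∑ F ∈ star Φ f, (-1 : AddMonoidAlgebra ℤ ℝ) ^ F.card = 0 := by
    refine Finset.sum_involution (fun F _ => if f ∈ F then F.erase f else insert f F) ?_ ?_ ?_ ?_
    · intro F _
      split_ifs with hf
      · rw [← Finset.card_erase_add_one hf]; ring
      · rw [Finset.card_insert_of_notMem hf]; ring
    · intro F _ _
      split_ifs with hf
      · exact fun h => Finset.notMem_erase f F (h.symm ▸ hf)
      · exact fun h => hf (h ▸ Finset.mem_insert_self f F)
    · intro F hF
      obtain ⟨-, h1, h2⟩ := Finset.mem_filter.1 hF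
      split_ifs with hf
      · exact Finset.mem_filter.2 ⟨h1, by simpa using h1, by
          rw [Finset.insert_erase hf]; exact (Finset.mem_filter.1 hF).1⟩
      · exact Finset.mem_filter.2 ⟨h2, by simpa using h1, by simpa using h2⟩
    · intro F _
      by_cases hf : f ∈ F
      · simp [hf]
      · simp [hf]
  have h := Finset.sum_sdiff (f := fun F => (-1 : AddMonoidAlgebra ℤ ℝ) ^ F.card)
    (Finset.filter_subset (fun F => F.erase f ∈ Φ ∧ insert f F ∈ Φ) Φ)
  rw [show ∑ F ∈ Φ with F.erase f ∈ Φ ∧ insert f F ∈ Φ, (-1 : AddMonoidAlgebra ℤ ℝ) ^ F.card = 0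
    from hs, add_zero] at h
  exact h

section Convex

variable {Φ : Finset (Finset α)}

lemma deletion_convex
    (hΦ : ∀ F ∈ Φ, ∀ H ∈ Φ, ∀ G : Finset α, F ⊆ G → G ⊆ H → G ∈ Φ) (f : α) :
    ∀ F ∈ deletion Φ f, ∀ H ∈ deletion Φ f, ∀ G : Finset α,
    F ⊆ G → G ⊆ H → G ∈ deletion Φ f := by
  intro F hF H hH G hFG hGH
  rw [mem_deletion] at *
  exact ⟨hΦ F hF.1 H hH.1 G hFG hGH, fun h => hH.2 (hGH h)⟩

lemma contraction_convex
    (hΦ : ∀ F ∈ Φ, ∀ H ∈ Φ, ∀ G : Finset α, F ⊆ G → G ⊆ H → G ∈ Φ) (f : α) :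
    ∀ F ∈ contraction Φ f, ∀ H ∈ contraction Φ f,
    ∀ G : Finset α, F ⊆ G → G ⊆ H → G ∈ contraction Φ f := by
  intro F hF H hH G hFG hGH
  rw [mem_contraction] at *
  exact ⟨fun h => hH.1 (hGH h), hΦ _ hF.2 _ hH.2 _ (Finset.insert_subset_insert _ hFG)
    (Finset.insert_subset_insert _ hGH)⟩

lemma reduction_convex
    (hΦ : ∀ F ∈ Φ, ∀ H ∈ Φ, ∀ G : Finset α, F ⊆ G → G ⊆ H → G ∈ Φ) (f : α) :
    ∀ F ∈ reduction Φ f, ∀ H ∈ reduction Φ f,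
    ∀ G : Finset α, F ⊆ G → G ⊆ H → G ∈ reduction Φ f := by
  intro F hF H hH G hFG hGH
  rw [mem_reduction] at *
  refine ⟨hΦ F hF.1 H hH.1 G hFG hGH, fun ⟨h1, h2⟩ => ?_⟩
  by_cases hf : f ∈ F
  · refine hH.2 ⟨hΦ _ h1 _ hH.1 _ (Finset.erase_subset_erase _ hGH) (Finset.erase_subset _ _), ?_⟩
    rw [Finset.insert_eq_of_mem (hGH (hFG hf))]
    exact hH.1
  · refine hF.2 ⟨by rw [Finset.erase_eq_of_notMem hf]; exact hF.1, ?_⟩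
    exact hΦ _ hF.1 _ h2 _ (Finset.subset_insert _ _) (Finset.insert_subset_insert _ hFG)

/-- The spectral recursion always holds after substituting `t = -1`. -/
lemma eval_neg_one_recursion
    (hΦ : ∀ F ∈ Φ, ∀ H ∈ Φ, ∀ G : Finset α, F ⊆ G → G ⊆ H → G ∈ Φ) (f : α) :
    (spectrumPolynomial Φ - (Polynomial.C (qPow 1) * spectrumPolynomial (deletion Φ f)
      + Polynomial.C (qPow 1) * Polynomial.X * spectrumPolynomial (contraction Φ f)
      + (1 - Polynomial.C (qPow 1)) * spectrumPolynomial (reduction Φ f))).eval (-1) = 0 := by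
  simp only [Polynomial.eval_sub, Polynomial.eval_add, Polynomial.eval_mul, Polynomial.eval_C,
    Polynomial.eval_X, Polynomial.eval_one, eval_neg_one_spectrumPolynomial _ hΦ,
    eval_neg_one_spectrumPolynomial _ (deletion_convex hΦ f),
    eval_neg_one_spectrumPolynomial _ (contraction_convex hΦ f),
    eval_neg_one_spectrumPolynomial _ (reduction_convex hΦ f), eulerChar_reduction]
  linear_combination qPow 1 * eulerChar_eq_deletion_sub_contraction Φ f

end Convex

end EulerCharacteristic

/-! ### Matroid closure and rank on finite sets. -/

section MatroidClosure

variable {α : Type*} (M : Matroid α) [M.Finite]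

open Classical in
/-- The closure operator of a finite matroid on finite sets. -/
noncomputable def closureFinset (F : Finset α) : Finset α :=
  (groundFinset M).filter fun x => x ∈ M.closure (F : Set α)

variable {M} {F G : Finset α} {a b e f x : α}

lemma mem_groundFinset : x ∈ groundFinset M ↔ x ∈ M.E := M.ground_finite.mem_toFinset

lemma mem_closureFinset : x ∈ closureFinset M F ↔ x ∈ M.closure (F : Set α) := by
  classical
  rw [closureFinset, Finset.mem_filter, mem_groundFinset]
  exact ⟨fun h => h.2, fun h => ⟨M.closure_subset_ground _ h, h⟩⟩

lemma coe_closureFinset : (closureFinset M F : Set α) = M.closure (F : Set α) := by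
  ext x; exact mem_closureFinset

lemma closureFinset_subset_ground : closureFinset M F ⊆ groundFinset M := fun _ hx =>
  mem_groundFinset.2 (M.closure_subset_ground _ (mem_closureFinset.1 hx))

lemma closureFinset_mono (h : F ⊆ G) : closureFinset M F ⊆ closureFinset M G := fun _ hx =>
  mem_closureFinset.2 (M.closure_subset_closure (Finset.coe_subset.2 h) (mem_closureFinset.1 hx))

lemma subset_closureFinset (h : M.Indep (F : Set α)) : F ⊆ closureFinset M F := fun _ hx =>
  mem_closureFinset.2 (M.subset_closure _ h.subset_ground hx)

lemma closureFinset_subset_of_subset (h : F ⊆ closureFinset M G) :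
    closureFinset M F ⊆ closureFinset M G := fun _ hx => mem_closureFinset.2 <|
  M.closure_subset_closure_of_subset_closure
    (fun _ hy => mem_closureFinset.1 (h hy)) (mem_closureFinset.1 hx)

lemma closureFinset_subset_of_closed (hG : closureFinset M G = G) (h : F ⊆ G) :
    closureFinset M F ⊆ G := (closureFinset_mono h).trans hG.subset

lemma closureFinset_idem : closureFinset M (closureFinset M F) = closureFinset M F := by
  ext x
  rw [mem_closureFinset, coe_closureFinset, M.closure_closure, mem_closureFinset]

variable (M) in
/-- The rank of a finite set, as a natural number. -/
noncomputable def rankNat (W : Finset α) : ℕ := (M.eRk (W : Set α)).toNat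

lemma card_eq_rankNat (hF : M.Indep (F : Set α)) : F.card = rankNat M (closureFinset M F) := by
  rw [rankNat, coe_closureFinset, M.eRk_closure_eq, hF.eRk_eq_encard,
    Set.encard_coe_eq_coe_finsetCard, ENat.toNat_natCast]

variable [DecidableEq α]

lemma indep_insert (h : M.Indep (F : Set α)) (hx : x ∈ groundFinset M)
    (hxF : x ∉ closureFinset M F) : M.Indep ((insert x F : Finset α) : Set α) := by
  rw [Finset.coe_insert]
  exact ((h.notMem_closure_iff (mem_groundFinset.1 hx)).1 (mt mem_closureFinset.2 hxF)).1

lemma notMem_closureFinset_of_indep_insert (h : M.Indep ((insert x F : Finset α) : Set α))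
    (hxF : x ∉ F) : x ∉ closureFinset M F := by
  rw [Finset.coe_insert] at h
  exact mt mem_closureFinset.1 (((h.subset (Set.subset_insert _ _)).notMem_closure_iff
    (h.subset_ground (Set.mem_insert _ _))).2 ⟨h, hxF⟩)

lemma mem_closureFinset_exchange (hx : x ∉ closureFinset M F)
    (hxa : x ∈ closureFinset M (insert a F)) : a ∈ closureFinset M (insert x F) := by
  rw [mem_closureFinset, Finset.coe_insert] at *
  exact M.mem_closure_insert hx hxa

/-- If `b` is not spanned by `F`, then what is spanned by both `F` and `F - a + b` is spanned by
`F - a`. -/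
lemma mem_closureFinset_erase (hF : M.Indep (F : Set α)) (hb : b ∉ closureFinset M F) (hx : x ∈ closureFinset M F)
    (hxb : x ∈ closureFinset M (insert b (F.erase a))) : x ∈ closureFinset M (F.erase a) := by
  by_contra h
  refine hb (closureFinset_subset_of_subset ?_ (mem_closureFinset_exchange h hxb))
  exact Finset.insert_subset hx ((Finset.erase_subset _ _).trans (subset_closureFinset hF))

/-- By exchange `a` lies in the closure of `F - a + b`, while `b` lies in that of `F`; so each set
spans the other. -/
lemma closureFinset_exchange (hF : M.Indep (F : Set α)) (ha : a ∈ F)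
    (hb : b ∈ closureFinset M F) (hbF : b ∉ F)
    (hF' : M.Indep ((insert b (F.erase a) : Finset α) : Set α)) :
    closureFinset M (insert b (F.erase a)) = closureFinset M F := by
  have hba : b ∉ closureFinset M (F.erase a) :=
    notMem_closureFinset_of_indep_insert hF' fun h => hbF (Finset.mem_of_mem_erase h)
  have haF' := mem_closureFinset_exchange hba (by rwa [Finset.insert_erase ha] : b ∈ _)
  refine (closureFinset_subset_of_subset (Finset.insert_subset hb
    ((Finset.erase_subset _ _).trans (subset_closureFinset hF)))).antisymm
    (closureFinset_subset_of_subset ?_)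
  rw [← Finset.insert_erase ha]
  refine Finset.insert_subset (by rwa [Finset.insert_erase ha]) ?_
  rw [Finset.erase_insert (Finset.notMem_erase _ _)]
  exact (Finset.subset_insert _ _).trans (subset_closureFinset hF')

end MatroidClosure

/-! ### Independent sets spanning `e`, and the stratification of their minors. -/

section SpanningFamily

variable {α : Type*} [LinearOrder α] (M : Matroid α) [M.Finite]

open Classical in
/-- The independent sets that avoid `e` and span `e`. -/
noncomputable def spanFamily (e : α) : Finset (Finset α) :=
  (groundFinset M).powerset.filter fun F =>
    M.Indep (F : Set α) ∧ e ∉ F ∧ e ∈ closureFinset M F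

variable {M} {F : Finset α} {e f : α}

lemma mem_spanFamily :
    F ∈ spanFamily M e ↔ M.Indep (F : Set α) ∧ e ∉ F ∧ e ∈ closureFinset M F := by
  classical
  rw [spanFamily, Finset.mem_filter, Finset.mem_powerset]
  exact ⟨fun h => h.2, fun h => ⟨fun x hx => mem_groundFinset.2 (h.1.subset_ground hx), h⟩⟩

lemma spanFamily_isInterval (e : α) : IsInterval (groundFinset M) (spanFamily M e) := by
  refine ⟨fun F hF x hx => mem_groundFinset.2 ((mem_spanFamily.1 hF).1.subset_ground hx),
    fun F hF H hH G hFG hGH => ?_⟩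
  rw [mem_spanFamily] at *
  exact ⟨hH.1.subset (Finset.coe_subset.2 hGH), fun h => hH.2.1 (hGH h),
    closureFinset_mono hFG hF.2.2⟩

lemma spanFamily_insert_mem (hF : F ∈ spanFamily M e) {v : α} (hv : v ∈ groundFinset M)
    (hvF : v ∉ closureFinset M F) : insert v F ∈ spanFamily M e := by
  rw [mem_spanFamily] at *
  refine ⟨indep_insert hF.1 hv hvF, fun h => ?_, closureFinset_mono (Finset.subset_insert _ _)
    hF.2.2⟩
  rcases Finset.mem_insert.1 h with rfl | h
  · exact hvF hF.2.2
  · exact hF.2.1 h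

lemma spanFamily_insert_notMem {v : α} (hv : v ∈ closureFinset M F)
    (hvF : v ∉ F) : insert v F ∉ spanFamily M e := fun h =>
  notMem_closureFinset_of_indep_insert (mem_spanFamily.1 h).1 hvF hv

lemma spanFamily_erase_mem (hF : F ∈ spanFamily M e) {a b : α}
    (hb : b ∉ closureFinset M F) (hi : insert b (F.erase a) ∈ spanFamily M e) :
    F.erase a ∈ spanFamily M e := by
  rw [mem_spanFamily] at *
  exact ⟨hF.1.subset (Finset.coe_subset.2 (Finset.erase_subset _ _)),
    fun h => hF.2.1 (Finset.mem_of_mem_erase h), mem_closureFinset_erase hF.1 hb hF.2.2 hi.2.2⟩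

lemma spanFamily_isStratified (e : α) :
    IsStratified (spanFamily M e) (closureFinset M) ((groundFinset M).erase e) where
  subset_ground F hF _ hx := Finset.mem_erase.2
    ⟨fun h => (mem_spanFamily.1 hF).2.1 (h ▸ hx), (spanFamily_isInterval e).1 F hF hx⟩
  subset_closure _ hF := subset_closureFinset (mem_spanFamily.1 hF).1
  insert_mem _ hF _ hv hvF := spanFamily_insert_mem hF (Finset.mem_of_mem_erase hv) hvF
  insert_notMem _ _ _ hv hvF := spanFamily_insert_notMem hv hvF
  erase_mem _ hF _ _ _ hb hi := spanFamily_erase_mem hF hb hi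
  closure_exchange _ hF _ ha _ hb hbF hi := closureFinset_exchange (mem_spanFamily.1 hF).1 ha hb
    hbF (mem_spanFamily.1 hi).1
  closure_erase _ _ _ _ _ := closureFinset_mono (Finset.erase_subset _ _)

lemma deletion_spanFamily_isStratified (e f : α) :
    IsStratified (deletion (spanFamily M e) f) (closureFinset M)
      (((groundFinset M).erase e).erase f) where
  subset_ground F hF x hx := Finset.mem_erase.2
    ⟨fun h => (mem_deletion.1 hF).2 (h ▸ hx),
      (spanFamily_isStratified e).subset_ground F (mem_deletion.1 hF).1 hx⟩
  subset_closure F hF := (spanFamily_isStratified e).subset_closure F (mem_deletion.1 hF).1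
  insert_mem F hF v hv hvF := by
    obtain ⟨hvf, hv⟩ := Finset.mem_erase.1 hv
    obtain ⟨hF, hf⟩ := mem_deletion.1 hF
    refine mem_deletion.2 ⟨(spanFamily_isStratified e).insert_mem F hF v hv hvF, fun h => ?_⟩
    exact (Finset.mem_insert.1 h).elim (fun h => hvf h.symm) hf
  insert_notMem F _ v hv hvF h := spanFamily_insert_notMem hv hvF (mem_deletion.1 h).1
  erase_mem F hF a _ b hb hi := mem_deletion.2
    ⟨spanFamily_erase_mem (mem_deletion.1 hF).1 hb (mem_deletion.1 hi).1,
      fun h => (mem_deletion.1 hF).2 (Finset.mem_of_mem_erase h)⟩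
  closure_exchange F hF a ha b hb hbF hi := (spanFamily_isStratified e).closure_exchange F
    (mem_deletion.1 hF).1 a ha b hb hbF (mem_deletion.1 hi).1
  closure_erase _ _ _ _ _ := closureFinset_mono (Finset.erase_subset _ _)

/-- Closures are taken after putting `f` back, so that the strata are labelled by flats of `M` and
can be compared with those of the other families. -/
lemma contraction_spanFamily_isStratified (e f : α) :
    IsStratified (contraction (spanFamily M e) f) (fun F => closureFinset M (insert f F))
      (((groundFinset M).erase e).erase f) where
  subset_ground F hF x hx := by
    obtain ⟨hf, hF⟩ := mem_contraction.1 hF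
    exact Finset.mem_erase.2 ⟨fun h => hf (h ▸ hx),
      (spanFamily_isStratified e).subset_ground _ hF (Finset.mem_insert_of_mem hx)⟩
  subset_closure F hF := (Finset.subset_insert _ _).trans
    ((spanFamily_isStratified e).subset_closure _ (mem_contraction.1 hF).2)
  insert_mem F hF v hv hvF := by
    obtain ⟨hvf, hv⟩ := Finset.mem_erase.1 hv
    obtain ⟨hf, hF⟩ := mem_contraction.1 hF
    refine mem_contraction.2 ⟨fun h => (Finset.mem_insert.1 h).elim (fun h => hvf h.symm) hf, ?_⟩
    rw [Finset.insert_comm]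
    exact (spanFamily_isStratified e).insert_mem _ hF v hv hvF
  insert_notMem F hF v hv hvF h := by
    obtain ⟨hf, h⟩ := mem_contraction.1 h
    rw [Finset.insert_comm] at h
    refine spanFamily_insert_notMem hv (fun hvF' => ?_) h
    -- The closure contains `f` itself, but adding `f` leaves the contraction.
    rcases Finset.mem_insert.1 hvF' with rfl | h'
    · exact hf (Finset.mem_insert_self _ _)
    · exact hvF h'
  erase_mem F hF a ha b hb hi := by
    obtain ⟨hf, hF⟩ := mem_contraction.1 hF
    obtain ⟨hf', hi⟩ := mem_contraction.1 hi
    have hfa : f ≠ a := fun h => hf (h ▸ ha)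
    rw [Finset.insert_comm, ← Finset.erase_insert_of_ne hfa] at hi
    refine mem_contraction.2 ⟨fun h => hf (Finset.mem_of_mem_erase h), ?_⟩
    rw [← Finset.erase_insert_of_ne hfa]
    exact spanFamily_erase_mem hF hb hi
  closure_exchange F hF a ha b hb hbF hi := by
    obtain ⟨hf, hF⟩ := mem_contraction.1 hF
    obtain ⟨hf', hi⟩ := mem_contraction.1 hi
    have hfa : f ≠ a := fun h => hf (h ▸ ha)
    have hbf : b ≠ f := fun h => hf' (h ▸ Finset.mem_insert_self _ _)
    rw [Finset.insert_comm, ← Finset.erase_insert_of_ne hfa] at hi ⊢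
    exact (spanFamily_isStratified e).closure_exchange _ hF a (Finset.mem_insert_of_mem ha) b hb
      (fun h => (Finset.mem_insert.1 h).elim hbf hbF) hi
  closure_erase _ _ _ _ _ := closureFinset_mono
    (Finset.insert_subset_insert _ (Finset.erase_subset _ _))

/-- A face of the reduction spans `f`, and `f` cannot be removed from it without losing `e`. -/
lemma mem_reduction_spanFamily (hf : f ∈ groundFinset M) :
    F ∈ reduction (spanFamily M e) f ↔ F ∈ spanFamily M e ∧ f ∈ closureFinset M F ∧
      (f ∈ F → e ∉ closureFinset M (F.erase f)) := by
  rw [mem_reduction]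
  refine and_congr_right fun hF => ?_
  by_cases hfF : f ∈ F
  · have h1 : F.erase f ∈ spanFamily M e ↔ e ∈ closureFinset M (F.erase f) := by
      rw [mem_spanFamily]
      rw [mem_spanFamily] at hF
      exact ⟨fun h => h.2.2, fun h => ⟨hF.1.subset (Finset.coe_subset.2 (Finset.erase_subset _ _)),
        fun h => hF.2.1 (Finset.mem_of_mem_erase h), h⟩⟩
    have h2 := subset_closureFinset (mem_spanFamily.1 hF).1 hfF
    rw [h1, Finset.insert_eq_of_mem hfF]
    tauto
  · have h1 : insert f F ∈ spanFamily M e ↔ f ∉ closureFinset M F :=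
      ⟨fun h h' => spanFamily_insert_notMem h' hfF h, fun h => spanFamily_insert_mem hF hf h⟩
    rw [h1, Finset.erase_eq_of_notMem hfF]
    tauto

/-- Here `f` stays in the ground set: every face of the reduction spans `f`, so `f` is never a
vertex that can be added. -/
lemma reduction_spanFamily_isStratified (e : α) (hf : f ∈ groundFinset M) :
    IsStratified (reduction (spanFamily M e) f) (closureFinset M) ((groundFinset M).erase e) where
  subset_ground F hF := (spanFamily_isStratified e).subset_ground F (mem_reduction.1 hF).1
  subset_closure F hF := (spanFamily_isStratified e).subset_closure F (mem_reduction.1 hF).1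
  insert_mem F hF v hv hvF := by
    rw [mem_reduction_spanFamily hf] at *
    obtain ⟨hF, hfF, hef⟩ := hF
    have hvf : v ≠ f := fun h => hvF (h ▸ hfF)
    refine ⟨(spanFamily_isStratified e).insert_mem F hF v hv hvF,
      closureFinset_mono (Finset.subset_insert _ _) hfF, fun hf' he => ?_⟩
    have hf' : f ∈ F := (Finset.mem_insert.1 hf').resolve_left hvf.symm
    rw [Finset.erase_insert_of_ne hvf] at he
    obtain ⟨hI, -, heF⟩ := mem_spanFamily.1 hF
    exact hef hf' (mem_closureFinset_erase hI hvF heF he)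
  insert_notMem F _ v hv hvF h := spanFamily_insert_notMem hv hvF (mem_reduction.1 h).1
  erase_mem F hF a ha b hb hi := by
    rw [mem_reduction_spanFamily hf] at *
    obtain ⟨hF, hfF, hef⟩ := hF
    obtain ⟨hi, hfi, hefi⟩ := hi
    refine ⟨spanFamily_erase_mem hF hb hi,
      mem_closureFinset_erase (mem_spanFamily.1 hF).1 hb hfF hfi, fun hfa he => ?_⟩
    exact hef (Finset.mem_of_mem_erase hfa) (closureFinset_mono
      (Finset.erase_subset_erase _ (Finset.erase_subset _ _)) he)
  closure_exchange F hF a ha b hb hbF hi := (spanFamily_isStratified e).closure_exchange F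
    (mem_reduction.1 hF).1 a ha b hb hbF (mem_reduction.1 hi).1
  closure_erase _ _ _ _ _ := closureFinset_mono (Finset.erase_subset _ _)

end SpanningFamily

/-! ### The defect of the recursion, flat by flat. -/

section Restriction

variable {α : Type*} [LinearOrder α] {M : Matroid α} [M.Finite] {e f : α} {U : Finset α}

lemma deletion_restrict (e f : α) (U : Finset α) :
    deletion ((spanFamily M e).filter fun F => closureFinset M F ⊆ U) f =
      (deletion (spanFamily M e) f).filter fun F => closureFinset M F ⊆ U := by
  rw [deletion, deletion, Finset.filter_filter, Finset.filter_filter]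
  exact Finset.filter_congr fun _ _ => and_comm

lemma contraction_restrict (e f : α) (U : Finset α) :
    contraction ((spanFamily M e).filter fun F => closureFinset M F ⊆ U) f =
      (contraction (spanFamily M e) f).filter fun F => closureFinset M (insert f F) ⊆ U := by
  ext F
  simp only [mem_contraction, Finset.mem_filter, and_assoc]

/-- As `U` is closed and contains `f`, adding or removing `f` keeps the closure inside `U`;
restriction therefore does not alter which faces lie in the star. -/
lemma reduction_restrict (e : α) (hf : f ∈ U) (hU : closureFinset M U = U) :
    reduction ((spanFamily M e).filter fun F => closureFinset M F ⊆ U) f =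
      (reduction (spanFamily M e) f).filter fun F => closureFinset M F ⊆ U := by
  ext F
  simp only [mem_reduction, Finset.mem_filter]
  constructor
  · rintro ⟨⟨hF, hFU⟩, h⟩
    refine ⟨⟨hF, fun h' => h ⟨⟨h'.1, ?_⟩, h'.2, ?_⟩⟩, hFU⟩
    · exact (closureFinset_mono (Finset.erase_subset _ _)).trans hFU
    · exact closureFinset_subset_of_closed hU (Finset.insert_subset hf
        (((spanFamily_isStratified e).subset_closure F hF).trans hFU))
  · rintro ⟨⟨hF, h⟩, hFU⟩
    exact ⟨⟨hF, hFU⟩, fun h' => h ⟨h'.1.1, h'.2.1⟩⟩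

lemma restrict_convex (e : α) (U : Finset α) :
    ∀ F ∈ (spanFamily M e).filter fun F => closureFinset M F ⊆ U,
    ∀ H ∈ (spanFamily M e).filter fun F => closureFinset M F ⊆ U, ∀ G : Finset α,
      F ⊆ G → G ⊆ H → G ∈ (spanFamily M e).filter fun F => closureFinset M F ⊆ U := by
  intro F hF H hH G hFG hGH
  rw [Finset.mem_filter] at *
  exact ⟨(spanFamily_isInterval e).2 F hF.1 H hH.1 G hFG hGH, (closureFinset_mono hGH).trans hH.2⟩

/-- The contribution of the flat `W` to the defect of the spectral recursion. -/
noncomputable def stratumDefect (M : Matroid α) [M.Finite] (e f : α) (W : Finset α) :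
    AddMonoidAlgebra ℤ ℝ :=
  stratumSum (spanFamily M e) (closureFinset M) W -
    if f ∈ W then
      qPow 1 * stratumSum (deletion (spanFamily M e) f) (closureFinset M) W
      + qPow 1 * stratumSum (contraction (spanFamily M e) f)
        (fun F => closureFinset M (insert f F)) W
      + (1 - qPow 1) * stratumSum (reduction (spanFamily M e) f) (closureFinset M) W
    else stratumSum (deletion (spanFamily M e) f) (closureFinset M) W

/-- No face with closure `W`, nor any of its facets, contains `f`, so the two down-Laplacians
coincide. -/
lemma stratumDefect_of_notMem {W : Finset α} (hf : f ∉ W) : stratumDefect M e f W = 0 := by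
  have hS : ((deletion (spanFamily M e) f).filter fun F => closureFinset M F = W) =
      (spanFamily M e).filter fun F => closureFinset M F = W := by
    ext F
    simp only [mem_deletion, Finset.mem_filter]
    refine ⟨fun h => ⟨h.1.1, h.2⟩, fun h => ⟨⟨h.1, fun hfF => hf ?_⟩, h.2⟩⟩
    exact h.2 ▸ (spanFamily_isStratified e).subset_closure F h.1 hfF
  rw [stratumDefect, if_neg hf, sub_eq_zero, stratumSum, stratumSum, hS]
  congr 1
  ext F F'
  refine (Finset.sum_subset (Finset.filter_subset _ _) fun H hH hHf => ?_).symm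
  by_contra h0
  obtain ⟨hF, hFW⟩ := Finset.mem_filter.1 F.2
  obtain ⟨a, ha, rfl⟩ := exists_eq_erase_of_incidence_ne_zero (left_ne_zero_of_mul h0)
  refine hHf (Finset.mem_filter.2 ⟨hH, fun hfF => hf ?_⟩)
  exact hFW ▸ (spanFamily_isStratified e).subset_closure _ hF (Finset.mem_of_mem_erase hfF)

lemma stratumDefect_of_not_closed {W : Finset α} (hW : closureFinset M W ≠ W) :
    stratumDefect M e f W = 0 := by
  have h : ∀ F, closureFinset M F ≠ W := fun F hF => hW (by rw [← hF, closureFinset_idem])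
  rw [stratumDefect, stratumSum_eq_zero fun F _ => h F, stratumSum_eq_zero fun F _ => h F,
    stratumSum_eq_zero fun F _ => h _, stratumSum_eq_zero fun F _ => h F]
  simp

/-- The spectral recursion defect of the faces spanned by the flat `U`, as a sum over flats. -/
lemma recursion_defect_eq_sum (hf : f ∈ U) (hU : closureFinset M U = U) :
    let Φ := (spanFamily M e).filter fun F => closureFinset M F ⊆ U
    spectrumPolynomial Φ - (Polynomial.C (qPow 1) * spectrumPolynomial (deletion Φ f)
      + Polynomial.C (qPow 1) * Polynomial.X * spectrumPolynomial (contraction Φ f)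
      + (1 - Polynomial.C (qPow 1)) * spectrumPolynomial (reduction Φ f)) =
    ∑ W ∈ U.powerset, Polynomial.monomial (rankNat M W)
      (qPow (U \ W).card * stratumDefect M e f W) := by
  intro Φ
  have hUE : U ⊆ groundFinset M := hU ▸ closureFinset_subset_ground
  have hfE := hUE hf
  have hclosed : ∀ F ⊆ U, closureFinset M F ⊆ U := fun F hF => closureFinset_subset_of_closed hU hF
  rw [deletion_restrict, contraction_restrict, reduction_restrict e hf hU,
    (spanFamily_isStratified e).spectrumPolynomial_restrict (rankNat M)
      (fun F hF => card_eq_rankNat (mem_spanFamily.1 hF).1) (fun F _ hF => hclosed F hF),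
    (deletion_spanFamily_isStratified e f).spectrumPolynomial_restrict (rankNat M)
      (fun F hF => card_eq_rankNat (mem_spanFamily.1 (mem_deletion.1 hF).1).1)
      (fun F _ hF => hclosed F hF),
    (contraction_spanFamily_isStratified e f).spectrumPolynomial_restrict
      -- Faces of the contraction have one element fewer than the rank of their label. The
      -- truncation at rank `0` is harmless, since a nonempty stratum has a label of positive rank.
      (fun W => rankNat M W - 1) (fun F hF => by
        obtain ⟨hfF, hF⟩ := mem_contraction.1 hF
        rw [← card_eq_rankNat (mem_spanFamily.1 hF).1, Finset.card_insert_of_notMem hfF]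
        rfl)
      (fun F _ hF => hclosed _ (Finset.insert_subset hf hF)),
    (reduction_spanFamily_isStratified e hfE).spectrumPolynomial_restrict (rankNat M)
      (fun F hF => card_eq_rankNat (mem_spanFamily.1 (mem_reduction.1 hF).1).1)
      (fun F _ hF => hclosed F hF)]
  simp only [Finset.mul_sum]
  rw [← Finset.sum_add_distrib, ← Finset.sum_add_distrib, ← Finset.sum_sub_distrib]
  refine Finset.sum_congr rfl fun W hW => ?_
  have hWU := Finset.mem_powerset.1 hW
  -- All closures contain `e`; once `e ∈ W`, removing `e` from the ground set does not affect the
  -- exponent `|U \ W|`.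
  by_cases heW : e ∈ W
  swap
  · have hΦ : ∀ F ∈ spanFamily M e, closureFinset M F ≠ W := fun F hF h =>
      heW (h ▸ (mem_spanFamily.1 hF).2.2)
    rw [stratumDefect, stratumSum_eq_zero hΦ,
      stratumSum_eq_zero fun F hF => hΦ F (mem_deletion.1 hF).1,
      stratumSum_eq_zero fun F hF => hΦ _ (mem_contraction.1 hF).2,
      stratumSum_eq_zero fun F hF => hΦ F (mem_reduction.1 hF).1]
    simp
  have hE : ((groundFinset M).erase e ∩ U) \ W = U \ W := by
    ext x
    simp only [Finset.mem_sdiff, Finset.mem_inter, Finset.mem_erase]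
    exact ⟨fun h => ⟨h.1.2, h.2⟩, fun h => ⟨⟨⟨fun hx => h.2 (hx ▸ heW), hUE h.1⟩, h.1⟩, h.2⟩⟩
  have hE' : ((((groundFinset M).erase e).erase f) ∩ U) \ W = (U \ W).erase f := by
    rw [← hE]
    ext x
    simp only [Finset.mem_sdiff, Finset.mem_inter, Finset.mem_erase]
    tauto
  have hcon : Polynomial.C (qPow 1) * Polynomial.X * Polynomial.monomial (rankNat M W - 1)
      (qPow ((U \ W).erase f).card * stratumSum (contraction (spanFamily M e) f)
        (fun F => closureFinset M (insert f F)) W) = Polynomial.monomial (rankNat M W)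
      (qPow 1 * (qPow ((U \ W).erase f).card * stratumSum (contraction (spanFamily M e) f)
        (fun F => closureFinset M (insert f F)) W)) := by
    by_cases h : ∃ F ∈ contraction (spanFamily M e) f, closureFinset M (insert f F) = W
    · obtain ⟨F, hF, rfl⟩ := h
      obtain ⟨hfF, hF⟩ := mem_contraction.1 hF
      have hr := card_eq_rankNat (mem_spanFamily.1 hF).1
      rw [Finset.card_insert_of_notMem hfF] at hr
      rw [← hr, Nat.add_sub_cancel, mul_assoc, Polynomial.X_mul_monomial,
        Polynomial.C_mul_monomial]
    · push Not at h
      simp [stratumSum_eq_zero h]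
  rw [hE, hE', hcon, Polynomial.C_mul_monomial, sub_mul, one_mul, Polynomial.C_mul_monomial,
    ← map_sub, ← map_add, ← map_add, ← map_sub, stratumDefect]
  congr 1
  split_ifs with hfW
  · rw [Finset.erase_eq_of_notMem fun h => (Finset.mem_sdiff.1 h).2 hfW]
    ring
  -- With `f ∉ W` the deletion has one vertex fewer outside `W`, which its factor `q` restores;
  -- contraction and reduction have no stratum at `W`.
  · have hc : qPow (U \ W).card = qPow 1 * qPow ((U \ W).erase f).card := by
      rw [← qPow_add, ← Finset.card_erase_add_one (Finset.mem_sdiff.2 ⟨hf, hfW⟩)]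
      push_cast
      rw [add_comm]
    rw [stratumSum_eq_zero (Φ := contraction _ _) fun F hF h => hfW ?_,
      stratumSum_eq_zero (Φ := reduction _ _) fun F hF h => hfW ?_, hc]
    · ring
    · exact h ▸ ((mem_reduction_spanFamily hfE).1 hF).2.1
    · exact h ▸ (spanFamily_isStratified e).subset_closure _ (mem_contraction.1 hF).2
        (Finset.mem_insert_self _ _)

/-- For a flat `U` containing `f`, induction leaves one monomial `t ^ rk U` in the defect of the
faces spanned by `U`. At `t = -1` it equals the defect of `U` up to sign, and there the recursion is
known. -/
lemma stratumDefect_eq_zero (W : Finset α) : stratumDefect M e f W = 0 := by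
  induction W using Finset.strongInduction with
  | H U ih =>
    by_cases hf : f ∈ U
    swap
    · exact stratumDefect_of_notMem hf
    by_cases hU : closureFinset M U = U
    swap
    · exact stratumDefect_of_not_closed hU
    have h := eval_neg_one_recursion (restrict_convex (M := M) e U) f
    rw [recursion_defect_eq_sum hf hU, Finset.sum_eq_single_of_mem U
      (Finset.mem_powerset.2 subset_rfl) fun W hW hWU => by
        rw [ih W ((Finset.mem_powerset.1 hW).ssubset_of_ne hWU), mul_zero, map_zero],
      Finset.sdiff_self, Finset.card_empty, Nat.cast_zero, qPow_zero, one_mul,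
      Polynomial.eval_monomial] at h
    rcases neg_one_pow_eq_or (AddMonoidAlgebra ℤ ℝ) (rankNat M U) with h1 | h1 <;>
      simpa [h1] using h

theorem recursionAt_spanFamily (hf : f ∈ groundFinset M) : RecursionAt (spanFamily M e) f := by
  have hE : closureFinset M (groundFinset M) = groundFinset M :=
    closureFinset_subset_ground.antisymm fun x hx => mem_closureFinset.2
      (M.subset_closure _ (fun y hy => mem_groundFinset.1 hy) hx)
  have h := recursion_defect_eq_sum (M := M) (e := e) hf hE
  rw [Finset.filter_true_of_mem fun F _ => closureFinset_subset_ground,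
    Finset.sum_eq_zero fun W _ => by rw [stratumDefect_eq_zero, mul_zero, map_zero]] at h
  exact sub_eq_zero.1 h

theorem spanFamily_satisfiesSpectralRecursion (M : Matroid α) [M.Finite] (e : α) :
    SatisfiesSpectralRecursion (groundFinset M) (spanFamily M e) :=
  ⟨spanFamily_isInterval e, fun _ hf => recursionAt_spanFamily hf⟩

end Restriction

/-! ### Identification of the matroid pair under both conventions for loops. -/

section MatroidPair

variable {α : Type*} [LinearOrder α] {M : Matroid α} [M.Finite] {e : α}

open Matroid

lemma mem_indepComplex {α : Type*} {M : Matroid α} [M.Finite] {F : Finset α} :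
    F ∈ indepComplex M ↔ M.Indep (F : Set α) := by
  classical
  rw [indepComplex, Finset.mem_filter, Finset.mem_powerset]
  exact ⟨fun h => h.2, fun h => ⟨fun x hx => mem_groundFinset.2 (h.subset_ground hx), h⟩⟩

lemma mem_indepComplex_delete {α : Type*} {M : Matroid α} [M.Finite] {e : α} {F : Finset α} :
    F ∈ indepComplex (M ＼ {e}) ↔ M.Indep (F : Set α) ∧ e ∉ F := by
  rw [mem_indepComplex, Matroid.delete_indep_iff, Set.disjoint_singleton_right, Finset.mem_coe]

/-- For `F` independent and avoiding `e`, adding `e` destroys independence exactly when `F` spans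
`e`. This includes loops, which every set spans. -/
lemma relPair_delete_contraction (he : e ∈ M.E) :
    relPair (indepComplex (M ＼ {e})) (contraction (indepComplex M) e) = spanFamily M e := by
  ext F
  rw [relPair, Finset.mem_sdiff, mem_indepComplex_delete, mem_contraction, mem_indepComplex,
    mem_spanFamily, and_assoc]
  refine and_congr_right fun hF => and_congr_right fun heF => ?_
  constructor
  · intro h
    by_contra h'
    exact h ⟨heF, indep_insert hF (mem_groundFinset.2 he) h'⟩
  · exact fun h h' => notMem_closureFinset_of_indep_insert h'.2 heF h

lemma indepComplex_contract_of_isNonloop (he : M.IsNonloop e) :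
    indepComplex (M ／ {e}) = contraction (indepComplex M) e := by
  ext F
  rw [mem_indepComplex, he.contractElem_indep_iff, mem_contraction, mem_indepComplex,
    Finset.coe_insert, Finset.mem_coe]

lemma indepComplex_contract_of_isLoop {α : Type*} {M : Matroid α} [M.Finite] {e : α}
    (he : M.IsLoop e) :
    indepComplex (M ／ {e}) = indepComplex (M ＼ {e}) := by
  ext F
  rw [mem_indepComplex, mem_indepComplex, contract_eq_delete_of_subset_loops (Set.singleton_subset_iff.2 he)]

lemma satisfiesSpectralRecursion_empty (E : Finset α) : SatisfiesSpectralRecursion E ∅ := by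
  refine ⟨⟨by simp, by simp⟩, fun v _ => ?_⟩
  simp [RecursionAt, spectrumPolynomial, deletion, contraction, reduction]

end MatroidPair

end SpectralRecursion

open SpectralRecursion Matroid in
/-- The first conjunct reads `IN(M/e)` as the contraction `IN(M)/e` of the independence complex,
which is the void complex if `e` is a loop, so that the pair is then `IN(M)`; the second reads it
as the independence complex of the matroid contraction. The two agree if `e` is not a loop. -/
theorem theorem5 {α : Type*} [LinearOrder α] (M : Matroid α) [M.Finite] (e : α) (he : e ∈ M.E) :
    SatisfiesSpectralRecursion (groundFinset M)
        (relPair (indepComplex (M ＼ {e})) (contraction (indepComplex M) e)) ∧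
      SatisfiesSpectralRecursion (groundFinset M)
        (relPair (indepComplex (M ＼ {e})) (indepComplex (M ／ {e}))) := by
  have h : SatisfiesSpectralRecursion (groundFinset M)
      (relPair (indepComplex (M ＼ {e})) (contraction (indepComplex M) e)) := by
    rw [relPair_delete_contraction he]
    exact spanFamily_satisfiesSpectralRecursion M e
  refine ⟨h, ?_⟩
  rcases M.isLoop_or_isNonloop e he with hl | hn
  · rw [indepComplex_contract_of_isLoop hl, relPair, Finset.sdiff_self]
    exact satisfiesSpectralRecursion_empty _
  · rwa [indepComplex_contract_of_isNonloop hn]
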